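/- All graphs are finite and simple. For positive integers $k,q$ with $k\ge 2q$, let $G_{k,q}$ be the circular clique: the graph with vertex set $\{0,1,\dots,k-1\}$ in which $i$ and $j$ are adjacent if and only if $q\le |i-j|\le k-q$. A $(k,q)$-colouring of a graph $G$ is a homomorphism $G\to G_{k,q}$, and $\chi_c(G)=\inf\{k/q : k\ge 2q\ge 2,\ G\to G_{k,q}\}$ is the circular chromatic number. A graph $G$ that has a $(k,q)$-colouring is called $(k,q)$-mixing if the graph whose vertices are the $(k,q)$-colourings of $G$, two being adjacent when they differ at exactly one vertex of $G$, is connected. The circular mixing threshold of $G$ is \[ M_c(G)=\inf\{r\in\mathbb{Q} : r\ge\chi_c(G)\text{ and } G \text{ is } (k',q')\text{-mixing for all positive integers } k',q' \text{ with } k'\ge 2q' \text{ and } k'/q'\ge r\}. \] Proposition. For all positive integers $k,q$ with $k\ge 2q$, the set in the definition of $M_c(G_{k,q})$ is nonempty, and \[ M_c(G_{k,q})\le\max\left\{\frac{k+1}{2},\ \left\lceil\frac{k}{q}\right\rceil+1\right\}. \] -/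

import Mathlib

/-- The circular clique `G_{k,q}` on `{0, …, k-1}`: `i` and `j` are adjacent when
`q ≤ |i - j| ≤ k - q` (computed in `ℤ`). For `q ≥ 1` the clause `i ≠ j` is implied by
`q ≤ |i - j|`; it only makes the definition loop-free for the unused value `q = 0`. -/
def circularClique (k q : ℕ) : SimpleGraph (Fin k) where
  Adj i j := i ≠ j ∧ (q : ℤ) ≤ |(i : ℤ) - (j : ℤ)| ∧ |(i : ℤ) - (j : ℤ)| ≤ (k : ℤ) - (q : ℤ)
  symm := ⟨fun i j h => by
    rw [abs_sub_comm (j : ℤ) (i : ℤ)]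
    exact ⟨h.1.symm, h.2⟩⟩
  loopless := ⟨fun _ h => h.1 rfl⟩

/-- The `H`-colour graph of `G`: its vertices are the homomorphisms `G → H`, two of them being
adjacent when they differ at exactly one vertex of `G`. -/
def colourGraph {V W : Type*} (G : SimpleGraph V) (H : SimpleGraph W) : SimpleGraph (G →g H) where
  Adj f g := ∃! v : V, f v ≠ g v
  symm := ⟨fun f g h => by simpa only [ne_comm] using h⟩
  loopless := ⟨fun _ h => by
    obtain ⟨v, hv, _⟩ := h
    exact hv rfl⟩

/-- `G` is `(k,q)`-mixing: it has a `(k,q)`-colouring and its `(k,q)`-colour graph is connected. -/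
def IsCircularMixing {V : Type*} (G : SimpleGraph V) (k q : ℕ) : Prop :=
  (colourGraph G (circularClique k q)).Connected

/-- The circular chromatic number
`χ_c(G) = inf {k / q : k, q positive integers, k ≥ 2 q, G → G_{k,q}}`. -/
noncomputable def circularChromaticNumber {V : Type*} (G : SimpleGraph V) : ℝ :=
  sInf {x : ℝ | ∃ k q : ℕ, 0 < q ∧ 2 * q ≤ k ∧ Nonempty (G →g circularClique k q) ∧
    x = (k : ℝ) / (q : ℝ)}

/-- The set of (real numbers that are) rationals `r ≥ χ_c(G)` such that `G` is `(k,q)`-mixing for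
all positive integers `k ≥ 2 q` with `k / q ≥ r` (the pairs `k, q` need not be coprime). -/
def circularMixingBounds {V : Type*} (G : SimpleGraph V) : Set ℝ :=
  {x : ℝ | ∃ r : ℚ, x = (r : ℝ) ∧ circularChromaticNumber G ≤ (r : ℝ) ∧
    ∀ k q : ℕ, 0 < q → 2 * q ≤ k → (r : ℝ) ≤ (k : ℝ) / (q : ℝ) → IsCircularMixing G k q}

/-- The circular mixing threshold `M_c(G)`, the infimum of `circularMixingBounds G`. That set is
bounded below by `χ_c(G)`, so the infimum is a genuine one as soon as the set is nonempty. -/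
noncomputable def circularMixingThreshold {V : Type*} (G : SimpleGraph V) : ℝ :=
  sInf (circularMixingBounds G)

/-! Write `t = ⌊K/Q⌋` and `m = ⌈k/q⌉`. If `K/Q` is at least the claimed bound, then `m < t`, `k ≤
2t` and `Q(k+1) ≤ 2K`. It is shown that every such pair `(K, Q)` is mixing, so the bound itself lies
in the set.

From `(K, Q)` to `t` colours: the colours `0, Q, …, (t-1)Q` form a copy of `K_t`. Push all colours
down as far as possible. If some vertex is alone in the window of `Q` colours starting at its own,
the circle can be cut there and the colours packed into a rotated copy of `K_t`. If no vertex is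
alone, a long chain of colours with step `Q` would need too many vertices, so all colours are
already in `K_t` (`exists_reachable_rot_comp`). A colouring that leaves one of the `t` colours free
absorbs the rotations, so `t`-mixing implies `(K, Q)`-mixing (`isCircularMixing_of_preconnected`).

`G_{k,q}` is `t`-mixing: since `k ≤ 2t`, some colour class has at most two vertices and so fits in
an interval of `q` vertices. Give that whole interval the class colour, then make the following
blocks of `q` vertices constant one by one. This leaves a `t`-colouring of `K_m`, and `m < t` gives
room to permute colours and to rotate the blocks (`circularClique_colourGraph_preconnected`). -/

open SimpleGraph

/-! ### Recolouring moves for general homomorphisms -/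

section Reconfiguration

variable {V W X : Type*} {G : SimpleGraph V} {H : SimpleGraph W}

theorem colourGraph_reachable_of_eq_off (f g : G →g H) (v : V) (h : ∀ u, u ≠ v → f u = g u) :
    (colourGraph G H).Reachable f g := by
  by_cases hv : f v = g v
  · have : f = g := by
      ext u
      by_cases hu : u = v
      · rw [hu, hv]
      · exact h u hu
    rw [this]
  · refine SimpleGraph.Adj.reachable (show ∃! v : V, f v ≠ g v from ⟨v, hv, fun u hu => ?_⟩)
    by_contra hne
    exact hu (h u hne)

/-- Two homomorphisms `f`, `g` such that `f u` and `g v` are adjacent along every edge `uv`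
are joined by changing the values of `f` into those of `g` in any order. -/
theorem colourGraph_reachable_of_cross [Finite V] (f g : G →g H)
    (h : ∀ u v, G.Adj u v → H.Adj (f u) (g v)) : (colourGraph G H).Reachable f g := by
  classical
  have := Fintype.ofFinite V
  let mix : Finset V → (G →g H) := fun S =>
    { toFun := fun v => if v ∈ S then g v else f v
      map_rel' := by
        intro u v huv
        by_cases hu : u ∈ S <;> by_cases hv : v ∈ S <;> simp only [hu, hv, if_true, if_false]
        · exact g.map_adj huv
        · exact (h v u huv.symm).symm
        · exact h u v huv
        · exact f.map_adj huv }
  have key : ∀ S : Finset V, (colourGraph G H).Reachable f (mix S) := by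
    intro S
    induction S using Finset.induction_on with
    | empty =>
      have : mix ∅ = f := by ext v; simp [mix]
      rw [this]
    | insert a S ha ih =>
      refine ih.trans (colourGraph_reachable_of_eq_off _ _ a fun u hu => ?_)
      simp [mix, hu]
  have : mix Finset.univ = g := by ext v; simp [mix]
  exact this ▸ key Finset.univ

theorem colourGraph_reachable_comp_left {H' : SimpleGraph X} (e : H →g H') {f g : G →g H}
    (h : (colourGraph G H).Reachable f g) :
    (colourGraph G H').Reachable (e.comp f) (e.comp g) := by
  obtain ⟨p⟩ := h
  induction p with
  | nil => rfl
  | @cons a b c hab _ ih =>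
    refine Reachable.trans ?_ ih
    obtain ⟨v, _, huniq⟩ := hab
    refine colourGraph_reachable_of_eq_off _ _ v fun u hu => ?_
    have : a u = b u := by
      by_contra hne
      exact hu (huniq u hne)
    simp [this]

/-- A change at `v` pulls back to a change on the fibre of `v` under `e`. The fibre is an
independent set, so its vertices can be changed one at a time. -/
theorem colourGraph_reachable_comp_right [Finite X] {G' : SimpleGraph X} (e : G' →g G)
    {f g : G →g H} (h : (colourGraph G H).Reachable f g) :
    (colourGraph G' H).Reachable (f.comp e) (g.comp e) := by
  obtain ⟨p⟩ := h
  induction p with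
  | nil => rfl
  | @cons a b c hab _ ih =>
    refine Reachable.trans ?_ ih
    obtain ⟨v, _, huniq⟩ := hab
    have heq : ∀ u, u ≠ v → a u = b u := fun u hu => by
      by_contra hne
      exact hu (huniq u hne)
    refine colourGraph_reachable_of_cross _ _ fun x y hxy => ?_
    have hadj := e.map_adj hxy
    change H.Adj (a (e x)) (b (e y))
    by_cases hy : e y = v
    · rw [heq (e x) (fun hx => hadj.ne (hx.trans hy.symm))]
      exact b.map_adj hadj
    · rw [← heq (e y) hy]
      exact a.map_adj hadj

theorem exists_hom_recolour_vertex (f : G →g H) (u : V) (c : W)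
    (h : ∀ w, G.Adj u w → H.Adj c (f w)) :
    ∃ g : G →g H, g u = c ∧ ∀ v, v ≠ u → g v = f v := by
  classical
  refine ⟨{ toFun := Function.update (⇑f) u c, map_rel' := ?_ }, ?_, ?_⟩
  · intro x y hxy
    by_cases hx : x = u
    · subst hx
      rw [Function.update_self, Function.update_of_ne hxy.ne']
      exact h y hxy
    · by_cases hy : y = u
      · subst hy
        rw [Function.update_self, Function.update_of_ne hx]
        exact (h x hxy.symm).symm
      · rw [Function.update_of_ne hx, Function.update_of_ne hy]
        exact f.map_adj hxy
  · exact Function.update_self u c (⇑f)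
  · intro v hv
    exact Function.update_of_ne hv c (⇑f)

/-- In a proper colouring, an independent set that contains the whole class of the colour `a`
may be recoloured with `a`. -/
theorem exists_reachable_recolour_set [Finite V] (f : G →g (⊤ : SimpleGraph W)) (S : Set V) (a : W)
    (hS : ∀ u ∈ S, ∀ v ∈ S, ¬ G.Adj u v) (ha : ∀ v, f v = a → v ∈ S) :
    ∃ g : G →g (⊤ : SimpleGraph W), (colourGraph G ⊤).Reachable f g ∧ (∀ v ∈ S, g v = a) ∧
      ∀ v, v ∉ S → g v = f v := by
  classical
  have hne : ∀ u v, G.Adj u v → v ∈ S → f u ≠ a := fun u v huv hv hu => hS u (ha u hu) v hv huv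
  let g : G →g (⊤ : SimpleGraph W) :=
    { toFun := fun v => if v ∈ S then a else f v
      map_rel' := by
        intro u v huv
        by_cases hu : u ∈ S <;> by_cases hv : v ∈ S <;>
          simp only [hu, hv, if_true, if_false, top_adj]
        · exact absurd huv (hS u hu v hv)
        · exact (hne v u huv.symm hu).symm
        · exact hne u v huv hv
        · exact (f.map_adj huv).ne }
  refine ⟨g, colourGraph_reachable_of_cross f g fun u v huv => ?_, fun v hv => if_pos hv,
    fun v hv => if_neg hv⟩
  rw [top_adj]
  by_cases hv : v ∈ S
  · rw [show g v = a from if_pos hv]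
    exact hne u v huv hv
  · rw [show g v = f v from if_neg hv]
    exact (f.map_adj huv).ne

end Reconfiguration

/-! ### Rotations of circular cliques and lowering of colours -/

section CircularClique

theorem circularClique_adj_iff {K Q : ℕ} (hQ : 0 < Q) (i j : Fin K) :
    (circularClique K Q).Adj i j ↔
      (i.val + Q ≤ j.val ∧ j.val + Q ≤ i.val + K) ∨ (j.val + Q ≤ i.val ∧ i.val + Q ≤ j.val + K) := by
  change (i ≠ j ∧ (Q : ℤ) ≤ |(i.val : ℤ) - (j.val : ℤ)| ∧
    |(i.val : ℤ) - (j.val : ℤ)| ≤ (K : ℤ) - (Q : ℤ)) ↔ _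
  rw [ne_eq, Fin.ext_iff]
  rcases abs_cases ((i.val : ℤ) - (j.val : ℤ)) with ⟨h, _⟩ | ⟨h, _⟩ <;> rw [h] <;> omega

theorem Nat.add_mod_eq_ite_of_lt {K i : ℕ} (c : ℕ) (hi : i < K) :
    (i + c) % K = if i + c % K < K then i + c % K else i + c % K - K := by
  have hc : c % K < K := Nat.mod_lt _ (by omega)
  rw [← Nat.add_mod_mod]
  split_ifs with h
  · exact Nat.mod_eq_of_lt h
  · rw [Nat.mod_eq_sub_mod (by omega), Nat.mod_eq_of_lt (by omega)]

/-- The rotation `i ↦ i + c` of the circular clique. -/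
def circularCliqueRot {K Q : ℕ} (hQ : 0 < Q) (c : ℕ) : circularClique K Q →g circularClique K Q where
  toFun i := ⟨(i.val + c) % K, Nat.mod_lt _ i.pos⟩
  map_rel' := by
    intro i j hij
    rw [circularClique_adj_iff hQ] at hij ⊢
    have hc : c % K < K := Nat.mod_lt _ i.pos
    have hi := i.isLt
    have hj := j.isLt
    simp only [Nat.add_mod_eq_ite_of_lt c hi, Nat.add_mod_eq_ite_of_lt c hj]
    split_ifs <;> omega

theorem circularCliqueRot_val {K Q : ℕ} (hQ : 0 < Q) (c : ℕ) (i : Fin K) :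
    (circularCliqueRot (K := K) hQ c i).val = (i.val + c) % K := rfl

theorem circularCliqueRot_comp {K Q : ℕ} (hQ : 0 < Q) (c d : ℕ) :
    (circularCliqueRot (K := K) hQ c).comp (circularCliqueRot hQ d) = circularCliqueRot hQ (c + d) := by
  ext i
  change ((i.val + d) % K + c) % K = (i.val + (c + d)) % K
  rw [Nat.mod_add_mod, add_assoc, add_comm d c]

theorem circularCliqueRot_comp_comp {V : Type*} {G : SimpleGraph V} {K Q : ℕ} (hQ : 0 < Q)
    (c d : ℕ) (f : G →g circularClique K Q) :
    (circularCliqueRot hQ c).comp ((circularCliqueRot hQ d).comp f) =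
      (circularCliqueRot hQ (c + d)).comp f := by
  rw [← circularCliqueRot_comp hQ c d]
  rfl

theorem circularCliqueRot_eq_id {K Q : ℕ} (hQ : 0 < Q) (c : ℕ) (hc : K ∣ c) :
    circularCliqueRot (K := K) hQ c = Hom.id := by
  ext i
  change (i.val + c) % K = i.val
  obtain ⟨d, rfl⟩ := hc
  rw [Nat.add_mul_mod_self_left, Nat.mod_eq_of_lt i.isLt]

/-- The homomorphism `j ↦ Q j` from the complete graph on `⌊K / Q⌋` vertices. -/
def completeToCircularClique (K : ℕ) {Q : ℕ} (hQ : 0 < Q) :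
    (⊤ : SimpleGraph (Fin (K / Q))) →g circularClique K Q where
  toFun j := ⟨Q * j.val, lt_of_lt_of_le (Nat.mul_lt_mul_of_pos_left j.isLt hQ) (Nat.mul_div_le K Q)⟩
  map_rel' := by
    intro i j hij
    rw [top_adj, ne_eq, Fin.ext_iff] at hij
    rw [circularClique_adj_iff hQ]
    have aux : ∀ a b : ℕ, b < K / Q → a < b → Q * a + Q ≤ Q * b ∧ Q * b + Q ≤ K := by
      intro a b hb hab
      have h1 : Q * (a + 1) ≤ Q * b := Nat.mul_le_mul_left _ hab
      have h2 : Q * (b + 1) ≤ Q * (K / Q) := Nat.mul_le_mul_left _ hb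
      have h3 := Nat.mul_div_le K Q
      rw [Nat.mul_add, Nat.mul_one] at h1 h2
      omega
    rcases Nat.lt_or_gt_of_ne hij with h | h
    · have := aux _ _ j.isLt h
      left; dsimp only; omega
    · have := aux _ _ i.isLt h
      right; dsimp only; omega

variable {V : Type*} {G : SimpleGraph V} {K Q : ℕ}

theorem exists_eq_completeToCircularClique_comp (hQ : 0 < Q) (f : G →g circularClique K Q)
    (h : ∀ v, ∃ j, j < K / Q ∧ (f v).val = Q * j) :
    ∃ φ : G →g (⊤ : SimpleGraph (Fin (K / Q))), f = (completeToCircularClique K hQ).comp φ := by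
  choose j hj hf using h
  refine ⟨{ toFun := fun v => ⟨j v, hj v⟩, map_rel' := ?_ }, ?_⟩
  · intro u v huv
    rw [top_adj, ne_eq, Fin.mk.injEq]
    intro he
    apply (f.map_adj huv).ne
    ext
    rw [hf, hf, he]
  · ext v
    exact hf v

/-- Lowering colours one unit at a time, as long as the property `P` is kept, leads to a colouring
in which every nonzero colour is either blocked by a neighbour or could only be lowered by
violating `P`. -/
theorem exists_reachable_lowered [Finite V] (hQ : 0 < Q) (P : (G →g circularClique K Q) → Prop)
    (f : G →g circularClique K Q) (hf : P f) :
    ∃ h : G →g circularClique K Q, (colourGraph G _).Reachable f h ∧ P h ∧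
      ∀ u, 0 < (h u).val →
        (∃ w, G.Adj u w ∧ ((h w).val + Q = (h u).val ∨ (h w).val + Q = (h u).val + K)) ∨
        ∃ g : G →g circularClique K Q, (g u).val + 1 = (h u).val ∧ (∀ v, v ≠ u → g v = h v) ∧
          ¬ P g := by
  classical
  have := Fintype.ofFinite V
  -- Take a reachable colouring satisfying `P` with the least sum of colours.
  obtain ⟨h, ⟨hr, hP⟩, hmin⟩ := WellFounded.has_min
    (measure fun h : G →g circularClique K Q => ∑ v, (h v).val).wf
    {h | (colourGraph G _).Reachable f h ∧ P h} ⟨f, Reachable.refl _, hf⟩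
  refine ⟨h, hr, hP, fun u hu => ?_⟩
  by_contra hcon
  push Not at hcon
  obtain ⟨hb, hg⟩ := hcon
  obtain ⟨g, hgu, hgv⟩ := exists_hom_recolour_vertex h u ⟨(h u).val - 1, by omega⟩ (by
    intro w huw
    have h1 := (circularClique_adj_iff hQ _ _).1 (h.map_adj huw)
    have h2 := hb w huw
    have h3 := (h w).isLt
    have h4 := (h u).isLt
    rw [circularClique_adj_iff hQ]
    dsimp only
    omega)
  have hgu' : (g u).val + 1 = (h u).val := by
    rw [hgu]
    dsimp only
    omega
  refine hmin g ⟨hr.trans (colourGraph_reachable_of_eq_off _ _ u fun v hv => (hgv v hv).symm),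
    hg g hgu' hgv⟩ ?_
  change ∑ v, (g v).val < ∑ v, (h v).val
  refine Finset.sum_lt_sum (fun v _ => ?_) ⟨u, Finset.mem_univ u, by omega⟩
  by_cases hv : v = u
  · subst hv; omega
  · rw [hgv v hv]

/-- If no edge crosses the cut between `K - 1` and `0` too closely, all colours can be moved to
multiples of `Q`. -/
theorem exists_reachable_completeToCircularClique_comp [Finite V] (hQ : 0 < Q) (hQK : Q ≤ K)
    (f : G →g circularClique K Q)
    (hf : ∀ u w, G.Adj u w → (f u).val < Q → (f w).val + Q ≤ K) :
    ∃ φ : G →g (⊤ : SimpleGraph (Fin (K / Q))),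
      (colourGraph G _).Reachable f ((completeToCircularClique K hQ).comp φ) := by
  classical
  obtain ⟨h, hr, hP, hlow⟩ := exists_reachable_lowered hQ
    (fun h => ∀ u w, G.Adj u w → (h u).val < Q → (h w).val + Q ≤ K) f hf
  have hdvd : ∀ n, ∀ u, (h u).val = n → Q ∣ n := by
    intro n
    induction n using Nat.strong_induction_on with
    | _ n ih =>
      intro u hu
      rcases Nat.eq_zero_or_pos n with rfl | hn
      · exact dvd_zero Q
      rcases hlow u (by omega) with ⟨w, huw, hw | hw⟩ | ⟨g, hgu, hgv, hg⟩
      · have := ih (h w).val (by omega) w rfl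
        rw [← hu, ← hw]
        exact (Nat.dvd_add_right this).2 dvd_rfl
      · have h1 := (h w).isLt
        have h2 := hP u w huw (by omega)
        omega
      -- Lowering `u` breaks the cut condition only by taking its colour from `Q` to `Q - 1`.
      · push Not at hg
        obtain ⟨x, y, hxy, hx, hy⟩ := hg
        by_cases hxu : x = u
        · subst hxu
          rw [hgv y hxy.ne'] at hy
          have : ¬ (h x).val < Q := fun hlt => absurd (hP x y hxy hlt) (by omega)
          rw [show n = Q by omega]
        · rw [hgv x hxu] at hx
          have h1 := hP x y hxy hx
          by_cases hyu : y = u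
          · subst hyu; omega
          · rw [hgv y hyu] at hy; omega
  have hmul : ∀ u, ∃ j, (h u).val = Q * j := fun u => hdvd _ u rfl
  have htop : ∀ u v, G.Adj u v → K < (h v).val + Q →
      Q ≤ (h u).val ∧ (h u).val + Q ≤ K := by
    intro u v huv hv
    have h1 : Q ≤ (h u).val := by
      by_contra hlt
      have := hP u v huv (by omega)
      omega
    have h2 := (circularClique_adj_iff hQ _ _).1 (h.map_adj huv)
    have h3 := (h v).isLt
    have h4 := (h u).isLt
    omega
  have hK : ∀ v : V, 0 < K := fun v => (h v).pos
  -- When `Q ∤ K`, the multiple `Q * (K / Q)` may still be in use. It is folded onto `0`, which the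
  -- cut condition allows.
  let g : G →g circularClique K Q :=
    { toFun := fun v => if K < (h v).val + Q then ⟨0, hK v⟩ else h v
      map_rel' := by
        intro u v huv
        have h0 := h.map_adj huv
        have h1 := htop u v huv
        have h2 := htop v u huv.symm
        split_ifs with hu hv hv
        · omega
        · rw [circularClique_adj_iff hQ]; left; dsimp only; omega
        · rw [circularClique_adj_iff hQ]; right; dsimp only; omega
        · exact h0 }
  have hhg : (colourGraph G _).Reachable h g := by
    refine colourGraph_reachable_of_cross _ _ fun u v huv => ?_
    by_cases hv : K < (h v).val + Q
    · rw [show g v = ⟨0, hK v⟩ from if_pos hv, circularClique_adj_iff hQ]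
      have := htop u v huv hv
      right; dsimp only; omega
    · rw [show g v = h v from if_neg hv]
      exact h.map_adj huv
  obtain ⟨φ, hφ⟩ := exists_eq_completeToCircularClique_comp hQ g (by
    intro v
    by_cases hv : K < (h v).val + Q
    · rw [show g v = ⟨0, hK v⟩ from if_pos hv]
      exact ⟨0, Nat.div_pos hQK hQ, rfl⟩
    · rw [show g v = h v from if_neg hv]
      obtain ⟨j, hj⟩ := hmul v
      refine ⟨j, ?_, hj⟩
      rw [Nat.lt_iff_add_one_le, Nat.le_div_iff_mul_le hQ]
      rw [hj] at hv
      nlinarith)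
  exact ⟨φ, hφ ▸ hr.trans hhg⟩

end CircularClique

/-! ### From `(K, Q)`-colourings to `⌊K / Q⌋`-colourings -/

section Gap

variable {V : Type*} {G : SimpleGraph V} {K Q : ℕ}

theorem two_mul_le_card_of_div_fibers [Fintype V] (p : V → ℕ) (Q t : ℕ)
    (h : ∀ j < t, ∃ u v, u ≠ v ∧ p u / Q = j ∧ p v / Q = j) :
    2 * t + (if ∃ v, p v / Q = t then 1 else 0) ≤ Fintype.card V := by
  classical
  have h1 : ∑ j ∈ Finset.range (t + 1), (Finset.univ.filter fun v => p v / Q = j).card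
      ≤ Fintype.card V := by
    rw [← Finset.card_biUnion]
    · exact Finset.card_le_univ _
    · intro i _ j _ hij
      rw [Function.onFun, Finset.disjoint_left]
      intro v hv hv'
      rw [Finset.mem_filter] at hv hv'
      exact hij (hv.2.symm.trans hv'.2)
  refine le_trans ?_ h1
  rw [Finset.sum_range_succ]
  refine Nat.add_le_add ?_ ?_
  · rw [mul_comm, ← smul_eq_mul, ← Finset.card_range t, ← Finset.sum_const, Finset.card_range]
    refine Finset.sum_le_sum fun j hj => ?_
    obtain ⟨u, v, huv, hu, hv⟩ := h j (Finset.mem_range.1 hj)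
    exact Finset.one_lt_card.2 ⟨u, by simp [hu], v, by simp [hv], huv⟩
  · split_ifs with hv
    · obtain ⟨v, hv⟩ := hv
      exact Finset.card_pos.2 ⟨v, by simp [hv]⟩
    · exact Nat.zero_le _

/-- If every window of `Q` consecutive colours that starts at a used colour holds two vertices,
then there is no chain of `⌊K / Q⌋ + 1` used colours with steps `Q`. -/
theorem not_exists_long_chain [Fintype V] (hQ : 0 < Q) (hn : Q * (Fintype.card V + 1) ≤ 2 * K)
    (c : V → ℕ) (hc : ∀ v, ∃ u, u ≠ v ∧ ∃ s, s < Q ∧ c u = (c v + s) % K) (y : ℕ) (hy : y < K)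
    (hchain : ∀ j, j ≤ K / Q → ∃ v, c v = (y + Q * j) % K) : False := by
  have hKQ := Nat.div_add_mod K Q
  set t := K / Q with ht
  have hmod : K % Q < Q := Nat.mod_lt _ hQ
  -- `p` measures colours cyclically from the start `y` of the chain.
  let p : V → ℕ := fun v => (c v + (K - y)) % K
  have hp : ∀ v z, z < K → c v = (y + z) % K → p v = z := by
    intro v z hz hv
    change (c v + (K - y)) % K = z
    rw [hv, Nat.mod_add_mod, show y + z + (K - y) = z + K by omega, Nat.add_mod_right,
      Nat.mod_eq_of_lt hz]
  have hdiv : ∀ j s, s < Q → (Q * j + s) / Q = j := by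
    intro j s hs
    rw [Nat.mul_add_div hQ, Nat.div_eq_of_lt hs, add_zero]
  have key := two_mul_le_card_of_div_fibers p Q t (by
    intro j hj
    obtain ⟨v, hv⟩ := hchain j hj.le
    obtain ⟨u, huv, s, hs, hu⟩ := hc v
    have hlt : Q * j + Q ≤ Q * t := by
      rw [← Nat.mul_succ]
      exact Nat.mul_le_mul_left _ hj
    refine ⟨u, v, huv, ?_, ?_⟩
    · rw [hp u (Q * j + s) (by omega) (by rw [hu, hv, Nat.mod_add_mod, add_assoc]), hdiv j s hs]
    · rw [hp v (Q * j) (by omega) hv]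
      exact hdiv j 0 hQ)
  have hbound : Q * (2 * t + 1 + (if ∃ v, p v / Q = t then 1 else 0)) ≤ 2 * K :=
    le_trans (Nat.mul_le_mul_left _ (by omega)) hn
  obtain ⟨v, hv⟩ := hchain t le_rfl
  -- If `Q ∣ K`, the `t` full windows with two vertices each already exceed the bound. Otherwise the
  -- last chain colour lies in the short remainder window and supplies one more vertex; the second
  -- vertex of its own window may have wrapped round.
  by_cases hr : K % Q = 0
  · have : Q * (2 * t + 1) ≤ 2 * K := le_trans (Nat.mul_le_mul_left _ (by omega)) hbound
    rw [Nat.mul_add, Nat.mul_left_comm] at this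
    omega
  · have hex : ∃ v, p v / Q = t := ⟨v, by
      rw [hp v (Q * t) (by omega) hv]
      exact hdiv t 0 hQ⟩
    rw [if_pos hex, Nat.mul_add, Nat.mul_add, Nat.mul_left_comm] at hbound
    omega

/-- When `2 K ≥ Q (|V| + 1)`, every `(K, Q)`-colouring can be changed into one whose colours lie
in a rotated copy of `{0, Q, 2 Q, …}`. -/
theorem exists_reachable_rot_comp [Fintype V] (hQ : 0 < Q) (hQK : Q ≤ K)
    (hn : Q * (Fintype.card V + 1) ≤ 2 * K) (f : G →g circularClique K Q) :
    ∃ (c : ℕ) (φ : G →g (⊤ : SimpleGraph (Fin (K / Q)))), (colourGraph G _).Reachable f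
      ((circularCliqueRot hQ c).comp ((completeToCircularClique K hQ).comp φ)) := by
  obtain ⟨h, hr, -, hlow⟩ := exists_reachable_lowered hQ (fun _ => True) f trivial
  -- With `v` alone in its window, rotating its colour to `0` leaves `1, …, Q - 1` unused, which
  -- gives the cut condition.
  by_cases halone : ∃ v, ∀ u, u ≠ v → ∀ s, s < Q → (h u).val ≠ ((h v).val + s) % K
  · obtain ⟨v, hv⟩ := halone
    have hvK := (h v).isLt
    set g := (circularCliqueRot hQ (K - (h v).val)).comp h with hg
    have hgv : ∀ u, (g u).val = ((h u).val + (K - (h v).val)) % K := fun u => rfl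
    have hsmall : ∀ u, (g u).val < Q → (g u).val = 0 := by
      intro u hu
      by_cases huv : u = v
      · rw [huv, hgv, show (h v).val + (K - (h v).val) = K by omega, Nat.mod_self]
      · refine absurd ?_ (hv u huv _ hu)
        rw [hgv, Nat.add_mod_mod, show (h v).val + ((h u).val + (K - (h v).val)) = (h u).val + K by
          omega, Nat.add_mod_right, Nat.mod_eq_of_lt (h u).isLt]
    obtain ⟨φ, hφ⟩ := exists_reachable_completeToCircularClique_comp hQ hQK g (by
      intro u w huw hu
      have h1 := (circularClique_adj_iff hQ _ _).1 (g.map_adj huw)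
      have h2 := hsmall u hu
      omega)
    refine ⟨(h v).val, φ, hr.trans ?_⟩
    have := colourGraph_reachable_comp_left (circularCliqueRot (K := K) hQ (h v).val) hφ
    rw [hg, circularCliqueRot_comp_comp,
      circularCliqueRot_eq_id hQ _ (by rw [Nat.add_sub_cancel' hvK.le]), Hom.id_comp] at this
    exact this
  · push Not at halone
    -- Every nonzero colour is blocked by one lying `Q` below it cyclically. Tracing blockers back
    -- either reaches `0` in fewer than `l` steps or exhibits `l + 1` used colours with step `Q`.
    have hchain : ∀ l, ∀ u, (∃ j, j < l ∧ (h u).val = (Q * j) % K) ∨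
        ∃ y, y < K ∧ (y + Q * l) % K = (h u).val ∧
          ∀ j, j ≤ l → ∃ v, (h v).val = (y + Q * j) % K := by
      intro l
      induction l with
      | zero =>
        intro u
        have hu : ((h u).val + Q * 0) % K = (h u).val := by
          rw [Nat.mul_zero, add_zero, Nat.mod_eq_of_lt (h u).isLt]
        refine Or.inr ⟨(h u).val, (h u).isLt, hu, fun j hj => ⟨u, ?_⟩⟩
        rw [Nat.le_zero.1 hj, hu]
      | succ l ih =>
        intro u
        rcases Nat.eq_zero_or_pos (h u).val with hu | hu
        · exact Or.inl ⟨0, Nat.succ_pos l, by rw [hu, Nat.mul_zero, Nat.zero_mod]⟩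
        obtain ⟨w, -, hw⟩ | ⟨g, -, -, hg⟩ := hlow u hu
        · have hwu : (h u).val = ((h w).val + Q) % K := by
            have := (h u).isLt
            rcases hw with hw | hw
            · rw [hw, Nat.mod_eq_of_lt this]
            · rw [hw, Nat.add_mod_right, Nat.mod_eq_of_lt this]
          rcases ih w with ⟨j, hj, hwj⟩ | ⟨y, hy, hyw, hyj⟩
          · refine Or.inl ⟨j + 1, Nat.succ_lt_succ hj, ?_⟩
            rw [hwu, hwj, Nat.mod_add_mod, Nat.mul_succ]
          · have hyu : (y + Q * (l + 1)) % K = (h u).val := by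
              rw [hwu, ← hyw, Nat.mod_add_mod, Nat.mul_succ, add_assoc]
            refine Or.inr ⟨y, hy, hyu, fun j hj => ?_⟩
            rcases Nat.lt_or_ge l j with hlj | hlj
            · exact ⟨u, by rw [← hyu, show j = l + 1 by omega]⟩
            · exact hyj j hlj
        · exact absurd trivial hg
    obtain ⟨φ, hφ⟩ := exists_eq_completeToCircularClique_comp hQ h (by
      intro u
      rcases hchain (K / Q) u with ⟨j, hj, hu⟩ | ⟨y, hy, -, hyj⟩
      · refine ⟨j, hj, ?_⟩
        rw [hu, Nat.mod_eq_of_lt]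
        exact lt_of_lt_of_le (Nat.mul_lt_mul_of_pos_left hj hQ) (Nat.mul_div_le K Q)
      · exact (not_exists_long_chain hQ hn (fun v => (h v).val) halone y hy hyj).elim)
    refine ⟨0, φ, ?_⟩
    rw [circularCliqueRot_eq_id hQ 0 (dvd_zero K), Hom.id_comp, ← hφ]
    exact hr

/-- A graph with a `(⌊K / Q⌋ - 1)`-colouring that is `⌊K / Q⌋`-mixing is `(K, Q)`-mixing if
`2 K ≥ Q (|V| + 1)`. -/
theorem isCircularMixing_of_preconnected [Fintype V] (hQ : 0 < Q) (hQK : Q ≤ K)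
    (hn : Q * (Fintype.card V + 1) ≤ 2 * K)
    (hmix : (colourGraph G (⊤ : SimpleGraph (Fin (K / Q)))).Preconnected)
    (ψ : G →g (⊤ : SimpleGraph (Fin (K / Q)))) (hψ : ∀ v, (ψ v).val + 1 < K / Q) :
    IsCircularMixing G K Q := by
  set b := (completeToCircularClique K hQ).comp ψ
  -- As `b` avoids the top colour `Q * (K / Q - 1)`, a shift by one keeps all colours at most `K -
  -- Q`, so the cut condition survives.
  have hstep : (colourGraph G _).Reachable ((circularCliqueRot hQ 1).comp b) b := by
    obtain ⟨φ, hφ⟩ := exists_reachable_completeToCircularClique_comp hQ hQK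
      ((circularCliqueRot hQ 1).comp b) (by
        intro u w _ _
        change (Q * (ψ w).val + 1) % K + Q ≤ K
        have h1 : Q * ((ψ w).val + 2) ≤ Q * (K / Q) := Nat.mul_le_mul_left _ (hψ w)
        have h2 := Nat.mul_div_le K Q
        have h3 := Nat.mod_le (Q * (ψ w).val + 1) K
        rw [Nat.mul_add] at h1
        omega)
    exact hφ.trans (colourGraph_reachable_comp_left _ (hmix φ ψ))
  have hrot : ∀ c, (colourGraph G _).Reachable ((circularCliqueRot hQ c).comp b) b := by
    intro c
    induction c with
    | zero => rw [circularCliqueRot_eq_id hQ 0 (dvd_zero K), Hom.id_comp]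
    | succ c ih =>
      have := colourGraph_reachable_comp_left (circularCliqueRot (K := K) hQ c) hstep
      rw [circularCliqueRot_comp_comp] at this
      exact this.trans ih
  have hall : ∀ f : G →g circularClique K Q, (colourGraph G _).Reachable f b := by
    intro f
    obtain ⟨c, φ, hf⟩ := exists_reachable_rot_comp hQ hQK hn f
    exact (hf.trans (colourGraph_reachable_comp_left _
      (colourGraph_reachable_comp_left _ (hmix φ ψ)))).trans (hrot c)
  exact (connected_iff _).2 ⟨fun f g => (hall f).trans (hall g).symm, ⟨b⟩⟩

end Gap

/-! ### Mixing of `G_{k,q}` with `t` colours -/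

section Mixing

variable {k q m t : ℕ}

/-- The complete graph `K_m` is `t`-mixing for `t > m`. -/
theorem colourGraph_complete_preconnected (h : m < t) :
    (colourGraph (⊤ : SimpleGraph (Fin m)) (⊤ : SimpleGraph (Fin t))).Preconnected := by
  classical
  have key : ∀ n, ∀ f g : (⊤ : SimpleGraph (Fin m)) →g (⊤ : SimpleGraph (Fin t)),
      (Finset.univ.filter fun i => f i ≠ g i).card = n → (colourGraph _ _).Reachable f g := by
    intro n
    induction n using Nat.strong_induction_on with
    | _ n ih =>
      intro f g hn
      by_cases hfg : ∀ i, f i = g i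
      · rw [show f = g from DFunLike.ext f g hfg]
      push Not at hfg
      obtain ⟨i, hi⟩ := hfg
      have hinj : ∀ (e : (⊤ : SimpleGraph (Fin m)) →g (⊤ : SimpleGraph (Fin t))) (a b : Fin m),
          e a = e b → a = b := fun e a b hab => by
        by_contra hne
        exact (e.map_adj ((top_adj a b).2 hne)).ne hab
      -- the case in which the wanted colour is not in use
      have free : ∀ f' : (⊤ : SimpleGraph (Fin m)) →g (⊤ : SimpleGraph (Fin t)),
          f' i ≠ g i → (∀ j, f' j ≠ g i) → (∀ j, f j = g j → f' j = g j) →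
          (colourGraph _ _).Reachable f' g := by
        intro f' hi' hfree hsub
        obtain ⟨f'', hf''i, hf''⟩ := exists_hom_recolour_vertex f' i (g i)
          fun w _ => (hfree w).symm
        refine (colourGraph_reachable_of_eq_off f' f'' i fun u hu => (hf'' u hu).symm).trans
          (ih _ ?_ f'' g rfl)
        rw [← hn]
        refine Finset.card_lt_card (Finset.ssubset_iff_of_subset (fun j hj => ?_) |>.2
          ⟨i, by simpa using hi, by simpa using hf''i⟩)
        rw [Finset.mem_filter] at hj ⊢
        refine ⟨Finset.mem_univ j, fun hjj => hj.2 ?_⟩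
        by_cases hji : j = i
        · rw [hji, hf''i]
        · rw [hf'' j hji, hsub j hjj]
      by_cases hocc : ∃ l, f l = g i
      · obtain ⟨l, hl⟩ := hocc
        have hli : l ≠ i := fun hli => hi (hli ▸ hl)
        -- The occupant `l` of the wanted colour moves to a spare colour. By injectivity of `g` it
        -- already disagreed with `g`, so no new disagreement arises.
        obtain ⟨d, hd⟩ : ∃ d, ∀ j, f j ≠ d := by
          by_contra hcon
          push Not at hcon
          have := Fintype.card_le_of_surjective f hcon
          simp only [Fintype.card_fin] at this
          omega
        obtain ⟨f', hf'l, hf'⟩ := exists_hom_recolour_vertex f l d fun w _ => (hd w).symm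
        refine (colourGraph_reachable_of_eq_off f f' l fun u hu => (hf' u hu).symm).trans
          (free f' ?_ ?_ ?_)
        · rw [hf' i hli.symm]
          exact hi
        · intro j
          by_cases hjl : j = l
          · rw [hjl, hf'l, ← hl]
            exact (hd l).symm
          · rw [hf' j hjl, ← hl]
            exact fun hjl' => hjl (hinj f _ _ hjl')
        · intro j hj
          have hjl : j ≠ l := by
            rintro rfl
            exact hli (hinj g _ _ (hj.symm.trans hl))
          rw [hf' j hjl, hj]
      · push Not at hocc
        exact free f hi hocc fun j hj => hj
  exact fun f g => key _ f g rfl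

/-- The colouring of `G_{k,q}` by consecutive blocks of `q` vertices. -/
def circularCliqueBlock (hq : 0 < q) (hm : k ≤ m * q) :
    circularClique k q →g (⊤ : SimpleGraph (Fin m)) where
  toFun i := ⟨i.val / q, (Nat.div_lt_iff_lt_mul hq).2 (lt_of_lt_of_le i.isLt hm)⟩
  map_rel' := by
    intro i j hij
    rw [circularClique_adj_iff hq] at hij
    rw [top_adj, ne_eq, Fin.mk.injEq]
    intro he
    have h1 := Nat.div_add_mod i.val q
    have h2 := Nat.div_add_mod j.val q
    have h3 := Nat.mod_lt i.val hq
    have h4 := Nat.mod_lt j.val hq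
    rw [he] at h1
    omega

/-- The start of block `i` serves as `w`, except for `i = 0` and `j > 1`: there vertex `0` may be
cyclically too close to the start of the last block, and `q - 1` is used. -/
theorem exists_adj_block_start (hq : 0 < q) (hkq : 2 * q ≤ k) {i j : ℕ} (hij : i < j)
    (hj : j * q < k) :
    ∃ w : Fin k, w.val / q = i ∧ (circularClique k q).Adj w ⟨j * q, hj⟩ := by
  have hle : (i + 1) * q ≤ j * q := Nat.mul_le_mul_right q hij
  rw [Nat.add_mul, Nat.one_mul] at hle
  have hdiv : i * q / q = i := Nat.mul_div_cancel i hq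
  rcases Nat.eq_zero_or_pos i with rfl | hi
  · rcases Nat.lt_or_ge 1 j with hj1 | hj1
    · have : 2 * q ≤ j * q := Nat.mul_le_mul_right q hj1
      refine ⟨⟨q - 1, by omega⟩, Nat.div_eq_of_lt (by dsimp only; omega), ?_⟩
      rw [circularClique_adj_iff hq]
      left; dsimp only; omega
    · obtain rfl : j = 1 := by omega
      refine ⟨⟨0, by omega⟩, Nat.zero_div q, ?_⟩
      rw [circularClique_adj_iff hq]
      left; dsimp only; omega
  · have : 1 * q ≤ i * q := Nat.mul_le_mul_right q hi
    refine ⟨⟨i * q, by omega⟩, hdiv, ?_⟩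
    rw [circularClique_adj_iff hq]
    left; dsimp only; omega

/-- A colouring of `G_{k,q}` that is constant on the first block can be made constant on all
blocks. -/
theorem exists_reachable_comp_block (hq : 0 < q) (hkq : 2 * q ≤ k) (hm : k ≤ m * q)
    (hm' : m * q < k + q) (f : circularClique k q →g (⊤ : SimpleGraph (Fin t)))
    (hf : ∀ u v : Fin k, u.val < q → v.val < q → f u = f v) :
    ∃ c : (⊤ : SimpleGraph (Fin m)) →g (⊤ : SimpleGraph (Fin t)),
      (colourGraph _ _).Reachable f (c.comp (circularCliqueBlock hq hm)) := by
  have hblocks : ∀ j, ∃ f' : circularClique k q →g (⊤ : SimpleGraph (Fin t)),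
      (colourGraph _ _).Reachable f f' ∧
      ∀ u v : Fin k, u.val / q = v.val / q → u.val / q < j + 1 → f' u = f' v := by
    intro j
    induction j with
    | zero =>
      refine ⟨f, Reachable.refl _, fun u v huv hu => hf u v ?_ ?_⟩
      · exact (Nat.div_lt_iff_lt_mul hq).1 hu |>.trans_eq (by omega)
      · rw [huv] at hu
        exact (Nat.div_lt_iff_lt_mul hq).1 hu |>.trans_eq (by omega)
    | succ j ih =>
      obtain ⟨f', hr, hf'⟩ := ih
      by_cases hj : (j + 1) * q < k
      · set a := f' ⟨(j + 1) * q, hj⟩ with ha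
        obtain ⟨g, hg, hgS, hgS'⟩ := exists_reachable_recolour_set f'
          {u : Fin k | u.val / q = j + 1} a (by
            intro u hu v hv huv
            -- The class of `a` stays inside the block: each earlier block is constant and contains
            -- a neighbour of the block's start, and every vertex of a later block is itself such a
            -- neighbour.
            exact ((circularCliqueBlock hq hm).map_adj huv).ne (Fin.ext (hu.trans hv.symm))) (by
            intro v hv
            by_contra hne
            rcases Nat.lt_or_gt_of_ne hne with hlt | hgt
            · obtain ⟨w, hw, hadj⟩ := exists_adj_block_start hq hkq hlt hj
              exact (f'.map_adj hadj).ne ((hf' w v hw (hw ▸ hlt)).trans hv)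
            · refine (f'.map_adj (v := ⟨(j + 1) * q, hj⟩) (w := v) ?_).ne hv.symm
              have h1 : (j + 1 + 1) * q ≤ v.val := (Nat.le_div_iff_mul_le hq).1 hgt
              have h2 : 1 * q ≤ (j + 1) * q := Nat.mul_le_mul_right q (by omega)
              have h3 := v.isLt
              rw [Nat.add_mul (j + 1)] at h1
              rw [circularClique_adj_iff hq]
              left; dsimp only; omega)
        refine ⟨g, hr.trans hg, fun u v huv hu => ?_⟩
        by_cases hu' : u.val / q = j + 1
        · rw [hgS u hu', hgS v (huv.symm.trans hu')]
        · rw [hgS' u hu', hgS' v (fun hv => hu' (huv.trans hv))]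
          exact hf' u v huv (by omega)
      · refine ⟨f', hr, fun u v huv hu => hf' u v huv ?_⟩
        refine (Nat.div_lt_iff_lt_mul hq).2 ?_
        have := u.isLt
        omega
  obtain ⟨g, hr, hg⟩ := hblocks m
  have hstart : ∀ j : Fin m, j.val * q < k := by
    intro j
    have : (j.val + 1) * q ≤ m * q := Nat.mul_le_mul_right q j.isLt
    rw [Nat.add_mul] at this
    omega
  have hlt : ∀ i j : Fin m, i < j → g ⟨i.val * q, hstart i⟩ ≠ g ⟨j.val * q, hstart j⟩ := by
    intro i j hij
    obtain ⟨w, hw, hadj⟩ := exists_adj_block_start hq hkq hij (hstart j)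
    have hwi := hg w ⟨i.val * q, hstart i⟩ (by rw [hw]; exact (Nat.mul_div_cancel _ hq).symm)
      (by rw [hw]; exact i.isLt.trans (Nat.lt_succ_self m))
    rw [← hwi]
    exact (g.map_adj hadj).ne
  let c : (⊤ : SimpleGraph (Fin m)) →g (⊤ : SimpleGraph (Fin t)) :=
    { toFun := fun j => g ⟨j.val * q, hstart j⟩
      map_rel' := by
        intro i j hij
        rw [top_adj] at hij ⊢
        rcases lt_or_gt_of_ne hij with h | h
        · exact hlt i j h
        · exact (hlt j i h).symm }
  have hgc : g = c.comp (circularCliqueBlock hq hm) := by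
    refine DFunLike.ext _ _ fun u => ?_
    refine hg u _ (Nat.mul_div_cancel _ hq).symm ?_
    exact (circularCliqueBlock hq hm u).isLt.trans (Nat.lt_succ_self m)
  exact ⟨c, hgc ▸ hr⟩

/-- If `2 t ≥ k`, some colour class of a `t`-colouring of `G_{k,q}` lies in an interval of `q`
consecutive vertices. -/
theorem exists_colour_class_subset_interval (hq : 0 < q) (hkq : 2 * q ≤ k) (ht : k ≤ 2 * t)
    (f : circularClique k q →g (⊤ : SimpleGraph (Fin t))) :
    ∃ (x : ℕ) (a : Fin t), ∀ v : Fin k, f (circularCliqueRot hq x v) = a → v.val < q := by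
  classical
  have : Nonempty (Fin t) := ⟨⟨0, by omega⟩⟩
  obtain ⟨a, ha⟩ := Fintype.exists_card_fiber_le_of_card_le_mul (f := f) (n := 2) (by
    rw [Fintype.card_fin, Fintype.card_fin]
    omega)
  by_cases hemp : ∃ x, f x = a
  swap
  · exact ⟨0, a, fun v hv => (hemp ⟨_, hv⟩).elim⟩
  obtain ⟨x, hx⟩ := hemp
  by_cases hall : ∀ v : Fin k, f (circularCliqueRot hq x.val v) = a → v.val < q
  · exact ⟨x.val, a, hall⟩
  push Not at hall
  obtain ⟨v, hv, hvq⟩ := hall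
  have hk : 0 < k := by omega
  have hx0 : circularCliqueRot hq x.val (⟨0, hk⟩ : Fin k) = x := by
    ext
    rw [circularCliqueRot_val]
    dsimp only
    rw [Nat.zero_add, Nat.mod_eq_of_lt x.isLt]
  have hvk : k < v.val + q := by
    by_contra hle
    refine (f.map_adj ((circularCliqueRot hq x.val).map_adj (v := (⟨0, hk⟩ : Fin k)) (w := v)
      ?_)).ne (by rw [hx0, hx, hv])
    rw [circularClique_adj_iff hq]
    left; dsimp only; omega
  -- The second vertex of the class precedes `x` by less than `q`, so the interval starts there; any
  -- vertex of the class outside it would be a third.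
  refine ⟨x.val + v.val, a, fun u hu => ?_⟩
  by_contra huq
  have hval : ∀ c : ℕ, ∀ w : Fin k, (circularCliqueRot hq c w).val =
      if w.val + c % k < k then w.val + c % k else w.val + c % k - k := fun c w => by
    rw [circularCliqueRot_val, Nat.add_mod_eq_ite_of_lt c w.isLt]
  have hxl := Nat.mod_eq_of_lt x.isLt
  have hvl := Nat.mod_eq_of_lt v.isLt
  have hxv : (x.val + v.val) % k =
      if x.val + v.val < k then x.val + v.val else x.val + v.val - k := by
    rw [Nat.add_mod_eq_ite_of_lt v.val x.isLt, hvl]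
  have h1 := hval x.val v
  have h2 := hval (x.val + v.val) u
  rw [hxl] at h1
  rw [hxv] at h2
  have h3 := u.isLt
  have h4 := v.isLt
  have h5 := x.isLt
  refine absurd ha (not_le.2 (Finset.two_lt_card.2 ⟨x, by simpa using hx,
    circularCliqueRot hq x.val v, by simpa using hv,
    circularCliqueRot hq (x.val + v.val) u, by simpa using hu, ?_, ?_, ?_⟩)) <;>
  · rw [ne_eq, Fin.ext_iff]
    split_ifs at h1 h2 <;> omega

/-- The circular clique `G_{k,q}` is `t`-mixing if `t > ⌈k / q⌉` and `2 t ≥ k`. -/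
theorem circularClique_colourGraph_preconnected (hq : 0 < q) (hkq : 2 * q ≤ k) (hm : k ≤ m * q)
    (hm' : m * q < k + q) (hmt : m < t) (ht : k ≤ 2 * t) :
    (colourGraph (circularClique k q) (⊤ : SimpleGraph (Fin t))).Preconnected := by
  classical
  let c₀ : (⊤ : SimpleGraph (Fin m)) →g (⊤ : SimpleGraph (Fin t)) :=
    { toFun := fun i => Fin.castLE hmt.le i
      map_rel' := by
        intro i j hij
        rw [top_adj, ne_eq, Fin.ext_iff] at hij ⊢
        exact hij }
  set b := c₀.comp (circularCliqueBlock hq hm)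
  have hbval : ∀ u : Fin k, (b u).val = u.val / q := fun _ => rfl
  have hbase : ∀ f : circularClique k q →g (⊤ : SimpleGraph (Fin t)),
      (∀ u v : Fin k, u.val < q → v.val < q → f u = f v) → (colourGraph _ _).Reachable f b := by
    intro f hf
    obtain ⟨c, hc⟩ := exists_reachable_comp_block hq hkq hm hm' f hf
    exact hc.trans (colourGraph_reachable_comp_right _ (colourGraph_complete_preconnected hmt c c₀))
  have hcompcomp : ∀ (g : circularClique k q →g (⊤ : SimpleGraph (Fin t))) (c d : ℕ),
      (g.comp (circularCliqueRot hq c)).comp (circularCliqueRot hq d) =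
        g.comp (circularCliqueRot hq (c + d)) := by
    intro g c d
    rw [← circularCliqueRot_comp hq c d]
    rfl
  have hone : (colourGraph _ _).Reachable (b.comp (circularCliqueRot hq 1)) b := by
    -- Vertex `0` takes the spare colour `m`, which frees colour `0` to be spread over `1, …, q`,
    -- the first block after rotation by one.
    obtain ⟨f₁, hr₁, hf₁, hf₁'⟩ := exists_reachable_recolour_set b {u : Fin k | u.val = 0}
      (⟨m, hmt⟩ : Fin t)
      (fun u hu v hv huv => huv.ne (Fin.ext (hu.trans hv.symm)))
      (fun v hv => by
        have h1 : v.val / q = m := by rw [← hbval, hv]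
        have h2 : v.val / q < m := (circularCliqueBlock hq hm v).isLt
        omega)
    obtain ⟨f₂, hr₂, hf₂, -⟩ := exists_reachable_recolour_set f₁
      {u : Fin k | 1 ≤ u.val ∧ u.val ≤ q} (⟨0, by omega⟩ : Fin t)
      (fun u hu v hv huv => by
        rw [circularClique_adj_iff hq] at huv
        rw [Set.mem_ofPred_eq] at hu hv
        omega)
      (fun v hv => by
        by_cases h0 : v.val = 0
        · rw [hf₁ v h0, Fin.mk.injEq] at hv
          rw [hv, Nat.zero_mul] at hm
          omega
        · rw [hf₁' v h0] at hv
          have h1 : v.val / q = 0 := by rw [← hbval, hv]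
          have h2 := (Nat.div_lt_iff_lt_mul hq).1 (h1.trans_lt Nat.one_pos)
          rw [Set.mem_ofPred_eq]
          omega)
    refine (colourGraph_reachable_comp_right _ (hr₁.trans hr₂)).trans (hbase _ ?_)
    have hmem : ∀ u : Fin k, u.val < q → f₂ (circularCliqueRot hq 1 u) = ⟨0, by omega⟩ := by
      intro u hu
      refine hf₂ _ ?_
      rw [Set.mem_ofPred_eq, circularCliqueRot_val, Nat.mod_eq_of_lt (by omega)]
      omega
    exact fun u v hu hv => (hmem u hu).trans (hmem v hv).symm
  have hrot : ∀ x, (colourGraph _ _).Reachable (b.comp (circularCliqueRot hq x)) b := by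
    intro x
    induction x with
    | zero =>
      rw [circularCliqueRot_eq_id hq 0 (dvd_zero k)]
      exact Reachable.refl _
    | succ x ih =>
      have := colourGraph_reachable_comp_right (circularCliqueRot (K := k) hq x) hone
      rw [hcompcomp, add_comm] at this
      exact this.trans ih
  have hall : ∀ f : circularClique k q →g (⊤ : SimpleGraph (Fin t)),
      (colourGraph _ _).Reachable f b := by
    intro f
    obtain ⟨x, a, hx⟩ := exists_colour_class_subset_interval hq hkq ht f
    obtain ⟨g, hr, hg, -⟩ := exists_reachable_recolour_set (f.comp (circularCliqueRot hq x))
      {u : Fin k | u.val < q} a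
      (fun u hu v hv huv => by
        rw [circularClique_adj_iff hq] at huv
        rw [Set.mem_ofPred_eq] at hu hv
        omega)
      hx
    have hfb := hr.trans (hbase g fun u v hu hv => (hg u hu).trans (hg v hv).symm)
    -- Rotation by `k * x - x` undoes rotation by `x`.
    have := colourGraph_reachable_comp_right (circularCliqueRot (K := k) hq (k * x - x)) hfb
    have hxk : x ≤ k * x := Nat.le_mul_of_pos_left x (by omega)
    rw [hcompcomp, Nat.add_sub_cancel' hxk, circularCliqueRot_eq_id hq _ (dvd_mul_right k x)] at this
    exact this.trans (hrot _)
  exact fun f g => (hall f).trans (hall g).symm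

end Mixing

/-! ### Numerical conditions and conclusion -/

theorem mainTheorem8 (k q : ℕ) (hq : 0 < q) (hkq : 2 * q ≤ k) :
    (circularMixingBounds (circularClique k q)).Nonempty ∧
      circularMixingThreshold (circularClique k q) ≤
        max (((k : ℝ) + 1) / 2) ((⌈(k : ℝ) / (q : ℝ)⌉ : ℝ) + 1) := by
  have hqR : (0 : ℝ) < q := by exact_mod_cast hq
  have hchi : ∀ y ∈ {x : ℝ | ∃ K Q : ℕ, 0 < Q ∧ 2 * Q ≤ K ∧
      Nonempty (circularClique k q →g circularClique K Q) ∧ x = (K : ℝ) / (Q : ℝ)}, 0 ≤ y := by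
    rintro y ⟨K, Q, -, -, -, rfl⟩
    positivity
  have hmem : max (((k : ℝ) + 1) / 2) ((⌈(k : ℝ) / (q : ℝ)⌉ : ℝ) + 1) ∈
      circularMixingBounds (circularClique k q) := by
    refine ⟨max (((k : ℚ) + 1) / 2) ((⌈(k : ℝ) / (q : ℝ)⌉ : ℚ) + 1), by push_cast; rfl, ?_, ?_⟩
    · have h1 : circularChromaticNumber (circularClique k q) ≤ (k : ℝ) / q :=
        csInf_le ⟨0, hchi⟩ ⟨k, q, hq, hkq, ⟨Hom.id⟩, rfl⟩
      have h2 := Int.le_ceil ((k : ℝ) / (q : ℝ))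
      push_cast
      exact h1.trans (le_max_of_le_right (by linarith))
    · intro K Q hQ _ hr
      push_cast at hr
      have hQR : (0 : ℝ) < Q := by exact_mod_cast hQ
      have h1 := (le_max_left _ _).trans hr
      have h2 := (le_max_right _ _).trans hr
      obtain ⟨m, hm⟩ : ∃ m : ℕ, ⌈(k : ℝ) / (q : ℝ)⌉ = m :=
        Int.eq_ofNat_of_zero_le (Int.ceil_nonneg (by positivity))
      have hm1 : k ≤ m * q := by
        have := Int.le_ceil ((k : ℝ) / (q : ℝ))
        rw [hm, div_le_iff₀ hqR] at this
        exact_mod_cast this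
      have hm2 : m * q < k + q := by
        have := Int.ceil_lt_add_one ((k : ℝ) / (q : ℝ))
        rw [hm, div_add_one hqR.ne', lt_div_iff₀ hqR] at this
        exact_mod_cast this
      have hn : Q * (k + 1) ≤ 2 * K := by
        rw [div_le_div_iff₀ two_pos hQR] at h1
        have : ((k : ℝ) + 1) * Q ≤ K * 2 := h1
        have : (k + 1) * Q ≤ K * 2 := by exact_mod_cast this
        linarith
      have hmt : m + 1 ≤ K / Q := by
        rw [hm, le_div_iff₀ hQR] at h2
        rw [Nat.le_div_iff_mul_le hQ]
        exact_mod_cast h2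
      have hQK : Q ≤ K := by
        have := (Nat.le_div_iff_mul_le hQ).1 hmt
        exact (Nat.le_mul_of_pos_left Q (Nat.succ_pos m)).trans this
      -- The `+ 1` in `(k + 1) / 2` pays for the floor: `k + 1 < 2 * (K / Q) + 2`.
      have ht : k ≤ 2 * (K / Q) := by
        have h3 := Nat.div_add_mod K Q
        have h4 := Nat.mod_lt K hQ
        have h5 : Q * (k + 1) < Q * (2 * (K / Q) + 2) := by
          rw [Nat.mul_add Q (2 * _), Nat.mul_left_comm]
          omega
        have := Nat.lt_of_mul_lt_mul_left h5
        omega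
      let c₀ : (⊤ : SimpleGraph (Fin m)) →g (⊤ : SimpleGraph (Fin (K / Q))) :=
        { toFun := fun i => Fin.castLE (Nat.le_of_succ_le hmt) i
          map_rel' := by
            intro i j hij
            rw [top_adj, ne_eq, Fin.ext_iff] at hij ⊢
            exact hij }
      refine isCircularMixing_of_preconnected hQ hQK (by rwa [Fintype.card_fin])
        (circularClique_colourGraph_preconnected hq hkq hm1 hm2 hmt ht)
        (c₀.comp (circularCliqueBlock hq hm1)) fun v => ?_
      have : (circularCliqueBlock hq hm1 v).val < m := (circularCliqueBlock hq hm1 v).isLt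
      exact lt_of_lt_of_le (Nat.succ_lt_succ this) hmt
  refine ⟨⟨_, hmem⟩, csInf_le ⟨0, ?_⟩ hmem⟩
  rintro y ⟨r, rfl, hy, -⟩
  exact (Real.sInf_nonneg hchi).trans hy
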